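/- Let \(q\ge 1\) be an integer, \(\alpha\in\mathbb R\), \(\kappa\in\{1,2,3,\dots\}\cup\{\infty\}\) (with \(\infty-1:=\infty\)), and let \((s_j)_{j=0}^{\kappa}\) be a sequence of complex \(q\times q\) matrices. **The transform.** \(A^\dagger\) denotes the Moore–Penrose inverse. Put \(u_0:=s_0\) and \(u_j:=-\alpha s_{j-1}+s_j\) for \(1\le j\le\kappa\). Define \(s_0^{\langle\alpha\rangle}:=u_0^\dagger\) and \(s_j^{\langle\alpha\rangle}:=-u_0^\dagger\sum_{l=0}^{j-1}u_{j-l}\,s_l^{\langle\alpha\rangle}\) for \(1\le j\le\kappa\). The transformed sequence is \(t_j:=-s_{j+1}^{\langle\alpha\rangle}\), \(0\le j\le\kappa-1\). **The classes.** For a sequence \((x_j)\) of complex \(q\times q\) matrices let \(H_n(x):=(x_{j+k})_{j,k=0}^n\), \(x^{(\alpha)}_j:=-\alpha x_j+x_{j+1}\), \(L_0(x):=x_0\), and for \(n\ge1\) \[L_n(x):=x_{2n}-(x_n,\dots,x_{2n-1})\,H_{n-1}(x)^\dagger\begin{pmatrix}x_n\\ \vdots\\ x_{2n-1}\end{pmatrix}.\]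 * \(\mathcal K^{\ge}_{m}\) (\(m\in\mathbb N_0\)) is the set of all \((x_j)_{j=0}^m\) such that: \(H_0(x)\) is non-negative Hermitian, if \(m=0\); \(H_n(x)\) and \(H_{n-1}(x^{(\alpha)})\) are non-negative Hermitian, if \(m=2n\) with \(n\ge1\); \(H_n(x)\) and \(H_n(x^{(\alpha)})\) are non-negative Hermitian, if \(m=2n+1\). \(\mathcal K^{>}_m\) is defined in the same way with "positive definite Hermitian" in place of "non-negative Hermitian". * \(\mathcal K^{\ge}_\infty\) (resp. \(\mathcal K^{>}_\infty\)) is the set of all \((x_j)_{j=0}^\infty\) with \((x_j)_{j=0}^m\in\mathcal K^{\ge}_m\) (resp. \(\mathcal K^{>}_m\)) for all \(m\in\mathbb N_0\). * \(\mathcal K^{\ge,e}_m\) (\(m\in\mathbb N_0\)) is the set of all \((x_j)_{j=0}^m\) for which there is a complex \(q\times q\) matrix \(x_{m+1}\) with \((x_j)_{j=0}^{m+1}\in\mathcal K^{\ge}_{m+1}\); and \(\mathcal K^{\ge,e}_\infty:=\mathcal K^{\ge}_\infty\). * \(\mathcal K^{\ge,cd}_{m}\) (\(m\in\mathbb N_0\))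 is the set of all \((x_j)_{j=0}^m\in\mathcal K^{\ge}_m\) such that, if \(m=2n\), \(H_n(x)\) is non-negative Hermitian and \(L_n(x)=0\), and, if \(m=2n+1\), \(H_n(x^{(\alpha)})\) is non-negative Hermitian and \(L_n(x^{(\alpha)})=0\). \(\mathcal K^{\ge,cd}_\infty\) is the set of all \((x_j)_{j=0}^\infty\in\mathcal K^{\ge}_\infty\) such that \((x_j)_{j=0}^m\in\mathcal K^{\ge,cd}_m\) for some \(m\in\mathbb N_0\). * \(\mathcal K^{\ge,cd,m}_{\lambda}\) (\(\lambda\in\mathbb N_0\cup\{\infty\}\), \(m\in\mathbb N_0\), \(m\le\lambda\)) is the set of all \((x_j)_{j=0}^{\lambda}\in\mathcal K^{\ge}_{\lambda}\) with \((x_j)_{j=0}^m\in\mathcal K^{\ge,cd}_m\). **Proposition P1542.** With this notation: 1. If \((s_j)_{j=0}^\kappa\in\mathcal K^{\ge}_\kappa\), then \((t_j)_{j=0}^{\kappa-1}\in\mathcal K^{\ge}_{\kappa-1}\). 2. If \((s_j)_{j=0}^\kappa\in\mathcal K^{\ge,e}_\kappa\), then \((t_j)_{j=0}^{\kappa-1}\in\mathcal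 K^{\ge,e}_{\kappa-1}\). 3. If \((s_j)_{j=0}^\kappa\in\mathcal K^{>}_\kappa\), then \((t_j)_{j=0}^{\kappa-1}\in\mathcal K^{>}_{\kappa-1}\). 4. If \(m\in\mathbb N_0\), \(m\le\kappa\), and \((s_j)_{j=0}^\kappa\in\mathcal K^{\ge,cd,m}_{\kappa}\), then \((t_j)_{j=0}^{\kappa-1}\in\mathcal K^{\ge,cd,\max\{0,m-1\}}_{\kappa-1}\). 5. If \((s_j)_{j=0}^\kappa\in\mathcal K^{\ge,cd}_\kappa\), then \((t_j)_{j=0}^{\kappa-1}\in\mathcal K^{\ge,cd}_{\kappa-1}\). -/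

import Mathlib

open scoped Matrix ComplexOrder

noncomputable section

namespace StieltjesSeq

/-! ### The Moore–Penrose inverse -/

/-- The four Penrose equations: `X` is the Moore–Penrose inverse of `A`. -/
structure IsMoorePenrose {m n : Type*} [Fintype m] [Fintype n]
    (A : Matrix m n ℂ) (X : Matrix n m ℂ) : Prop where
  mul_mul_left : A * X * A = A
  mul_mul_right : X * A * X = X
  isHermitian_left : (A * X)ᴴ = A * X
  isHermitian_right : (X * A)ᴴ = X * A

/-- A Hermitian matrix has a Hermitian Moore–Penrose inverse, which commutes with it. -/
theorem exists_pinv_of_isHermitian {n : Type*} [Fintype n] [DecidableEq n]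
    (B : Matrix n n ℂ) (hB : B.IsHermitian) :
    ∃ Y : Matrix n n ℂ, B * Y * B = B ∧ Y * B * Y = Y ∧ Yᴴ = Y ∧ B * Y = Y * B := by
  obtain ⟨U, d, hU, hU', hBd⟩ : ∃ (U : Matrix n n ℂ) (d : n → ℝ), Uᴴ * U = 1 ∧ U * Uᴴ = 1 ∧
      B = U * Matrix.diagonal (fun i => (d i : ℂ)) * Uᴴ := by
    refine ⟨hB.eigenvectorUnitary, hB.eigenvalues, ?_, ?_, ?_⟩
    · simpa [Matrix.star_eq_conjTranspose] using
        (Matrix.mem_unitaryGroup_iff'.mp hB.eigenvectorUnitary.2)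
    · simpa [Matrix.star_eq_conjTranspose] using
        (Matrix.mem_unitaryGroup_iff.mp hB.eigenvectorUnitary.2)
    · have h := hB.spectral_theorem
      rw [Unitary.conjStarAlgAut_apply] at h
      simpa [Matrix.star_eq_conjTranspose, Function.comp_def] using h
  have key : ∀ D E : Matrix n n ℂ, (U * D * Uᴴ) * (U * E * Uᴴ) = U * (D * E) * Uᴴ := by
    intro D E
    calc (U * D * Uᴴ) * (U * E * Uᴴ) = U * D * (Uᴴ * U) * E * Uᴴ := by
          simp only [Matrix.mul_assoc]
      _ = U * (D * E) * Uᴴ := by rw [hU]; simp only [Matrix.mul_assoc, Matrix.mul_one]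
  refine ⟨U * Matrix.diagonal (fun i => ((d i : ℂ))⁻¹) * Uᴴ, ?_, ?_, ?_, ?_⟩
  · rw [hBd, key, key, Matrix.diagonal_mul_diagonal, Matrix.diagonal_mul_diagonal]
    congr 3
    ext1 i
    exact mul_inv_mul_cancel _
  · rw [hBd, key, key, Matrix.diagonal_mul_diagonal, Matrix.diagonal_mul_diagonal]
    congr 3
    ext1 i
    by_cases h : (d i : ℂ) = 0 <;> simp [h]
  · simp only [Matrix.conjTranspose_mul, Matrix.conjTranspose_conjTranspose,
      Matrix.diagonal_conjTranspose, Matrix.mul_assoc]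
    congr 3
    ext1 i
    simp
  · rw [hBd, key, key, Matrix.diagonal_mul_diagonal, Matrix.diagonal_mul_diagonal]
    congr 3
    ext1 i
    exact mul_comm _ _

/-- Every complex matrix has a Moore–Penrose inverse. -/
theorem exists_isMoorePenrose {m n : Type*} [Fintype m] [Fintype n]
    (A : Matrix m n ℂ) : ∃ X : Matrix n m ℂ, IsMoorePenrose A X := by
  classical
  obtain ⟨Y, h1, h2, h3, h4⟩ := exists_pinv_of_isHermitian (Aᴴ * A)
    (Matrix.isHermitian_conjTranspose_mul_self A)
  have hP : (Y * (Aᴴ * A))ᴴ = Y * (Aᴴ * A) := by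
    rw [Matrix.conjTranspose_mul, h3, Matrix.conjTranspose_mul,
      Matrix.conjTranspose_conjTranspose, h4]
  have hA : A * (Y * (Aᴴ * A)) = A := by
    have h0 : (A - A * (Y * (Aᴴ * A)))ᴴ * (A - A * (Y * (Aᴴ * A))) = 0 := by
      have e : (Aᴴ * A) * (Y * (Aᴴ * A)) = Aᴴ * A := by rw [← Matrix.mul_assoc, h1]
      rw [Matrix.conjTranspose_sub, Matrix.conjTranspose_mul, hP, Matrix.sub_mul,
        Matrix.mul_sub, Matrix.mul_assoc, ← Matrix.mul_assoc Aᴴ A, e, sub_self, zero_sub,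
        Matrix.mul_sub, ← Matrix.mul_assoc Aᴴ A, e, sub_self, Matrix.mul_zero, neg_zero]
    exact (sub_eq_zero.mp (Matrix.conjTranspose_mul_self_eq_zero.mp h0)).symm
  refine ⟨Y * Aᴴ, ⟨?_, ?_, ?_, ?_⟩⟩
  · rw [Matrix.mul_assoc, Matrix.mul_assoc Y, hA]
  · rw [Matrix.mul_assoc Y, ← Matrix.mul_assoc, h2]
  · rw [Matrix.conjTranspose_mul, Matrix.conjTranspose_mul, Matrix.conjTranspose_conjTranspose,
      h3, Matrix.mul_assoc]
  · rw [Matrix.mul_assoc, hP]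

/-- The Moore–Penrose inverse `A^†` is unique. -/
theorem IsMoorePenrose.unique {m n : Type*} [Fintype m] [Fintype n]
    {A : Matrix m n ℂ} {X Y : Matrix n m ℂ} (hX : IsMoorePenrose A X)
    (hY : IsMoorePenrose A Y) : X = Y := by
  have e1 : A * X = A * Y := by
    calc A * X = (A * Y) * (A * X) := by rw [← Matrix.mul_assoc, hY.mul_mul_left]
      _ = ((A * X) * (A * Y))ᴴ := by
        rw [Matrix.conjTranspose_mul (A * X), hX.isHermitian_left, hY.isHermitian_left]
      _ = A * Y := by rw [← Matrix.mul_assoc, hX.mul_mul_left, hY.isHermitian_left]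
  have e2 : X * A = Y * A := by
    calc X * A = (X * A) * (Y * A) := by
          rw [Matrix.mul_assoc, ← Matrix.mul_assoc A, hY.mul_mul_left]
      _ = ((Y * A) * (X * A))ᴴ := by
        rw [Matrix.conjTranspose_mul (Y * A), hX.isHermitian_right, hY.isHermitian_right]
      _ = Y * A := by
        rw [Matrix.mul_assoc, ← Matrix.mul_assoc A, hX.mul_mul_left, hY.isHermitian_right]
  calc X = X * A * X := hX.mul_mul_right.symm
    _ = Y * A * Y := by rw [e2, Matrix.mul_assoc, e1, ← Matrix.mul_assoc]
    _ = Y := hY.mul_mul_right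

/-- The Moore–Penrose inverse `A^†`. -/
def pinv {m n : Type*} [Fintype m] [Fintype n] (A : Matrix m n ℂ) : Matrix n m ℂ :=
  Classical.choose (exists_isMoorePenrose A)

theorem isMoorePenrose_pinv {m n : Type*} [Fintype m] [Fintype n] (A : Matrix m n ℂ) :
    IsMoorePenrose A (pinv A) :=
  Classical.choose_spec (exists_isMoorePenrose A)

/-! ### Sequences and the transforms

A sequence `(s_j)_{j=0}^κ` of complex `p × q` matrices is represented by a function `s` on `ℕ`,
of which only the values `s j` with `j ≤ κ` matter: for a sequence of length `κ`, every notion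
below looks only at `s 0, …, s κ`. -/

variable {p q : ℕ}

/-- The right α-shifted sequence `-α s_j + s_{j+1}`, `0 ≤ j ≤ κ - 1`. -/
def shiftSeq (α : ℂ) (s : ℕ → Matrix (Fin p) (Fin q) ℂ) : ℕ → Matrix (Fin p) (Fin q) ℂ :=
  fun j => -(α • s j) + s (j + 1)

/-- The `[+,α]`-transform `-α s_{j-1} + s_j`, `0 ≤ j ≤ κ`, where `s_{-1} = 0`. -/
def plusSeq (α : ℂ) (s : ℕ → Matrix (Fin p) (Fin q) ℂ) : ℕ → Matrix (Fin p) (Fin q) ℂ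
  | 0 => s 0
  | j + 1 => -(α • s j) + s (j + 1)

/-- The reciprocal sequence: `s_0^# = s_0^†` and
`s_j^# = - s_0^† ∑_{l=0}^{j-1} s_{j-l} s_l^#` for `j ≥ 1`. -/
def recipSeq (s : ℕ → Matrix (Fin p) (Fin q) ℂ) : ℕ → Matrix (Fin q) (Fin p) ℂ
  | 0 => pinv (s 0)
  | j + 1 => -(pinv (s 0) * ∑ l : Fin (j + 1), s (j + 1 - (l : ℕ)) * recipSeq s l)

/-- The sequence `-s_{j+1}^{⟨α⟩}`, `0 ≤ j ≤ κ - 1`, where `s^{⟨α⟩}` is the reciprocal sequence of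
the `[+,α]`-transform of `s`. -/
def shortNegRecip (α : ℂ) (s : ℕ → Matrix (Fin p) (Fin q) ℂ) : ℕ → Matrix (Fin q) (Fin p) ℂ :=
  fun j => -recipSeq (plusSeq α s) (j + 1)

/-! ### Block Hankel matrices -/

/-- The block Hankel matrix `H_n = (s_{j+k})_{j,k=0}^n`. -/
def blockHankel (s : ℕ → Matrix (Fin p) (Fin q) ℂ) (n : ℕ) :
    Matrix (Fin (n + 1) × Fin p) (Fin (n + 1) × Fin q) ℂ :=
  Matrix.of fun a b => s ((a.1 : ℕ) + (b.1 : ℕ)) a.2 b.2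

/-- The block column `col (s_l, …, s_{l+n})`. -/
def blockCol (s : ℕ → Matrix (Fin p) (Fin q) ℂ) (l n : ℕ) :
    Matrix (Fin (n + 1) × Fin p) (Fin q) ℂ :=
  Matrix.of fun a b => s (l + (a.1 : ℕ)) a.2 b

/-- The block row `(s_l, …, s_{l+n})`. -/
def blockRow (s : ℕ → Matrix (Fin p) (Fin q) ℂ) (l n : ℕ) :
    Matrix (Fin p) (Fin (n + 1) × Fin q) ℂ :=
  Matrix.of fun a b => s (l + (b.1 : ℕ)) a b.2

/-- `L_0 = s_0` and `L_n = s_{2n} - (s_n, …, s_{2n-1}) H_{n-1}^† col (s_n, …, s_{2n-1})` for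
`n ≥ 1`. -/
def schurL (s : ℕ → Matrix (Fin p) (Fin q) ℂ) : ℕ → Matrix (Fin p) (Fin q) ℂ
  | 0 => s 0
  | n + 1 => s (2 * (n + 1)) -
      blockRow s (n + 1) n * pinv (blockHankel s n) * blockCol s (n + 1) n

/-! ### The classes of sequences of `q × q` matrices -/

/-- `(s_j)_{j=0}^{2n}` is Hankel non-negative definite and completely degenerate. -/
def HankelCD (n : ℕ) (s : ℕ → Matrix (Fin q) (Fin q) ℂ) : Prop :=
  (blockHankel s n).PosSemidef ∧ schurL s n = 0

/-- The class `K^≥` for `(s_j)_{j=0}^m`, `m` finite. For `m = 0` the condition is `H_0 ≥ 0`. For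
`m = 2n ≥ 2` it says that `H_n` and the `H_{n-1}` of the shifted sequence are `≥ 0`, and for
`m = 2n + 1` that `H_n` and the `H_n` of the shifted sequence are `≥ 0`. -/
def KGeFin (α : ℝ) (m : ℕ) (s : ℕ → Matrix (Fin q) (Fin q) ℂ) : Prop :=
  (blockHankel s (m / 2)).PosSemidef ∧
    (1 ≤ m → (blockHankel (shiftSeq (α : ℂ) s) ((m - 1) / 2)).PosSemidef)

/-- The class `K^≥` for `(s_j)_{j=0}^κ`, `κ ∈ ℕ₀ ∪ {∞}`. -/
def KGe (α : ℝ) (κ : ℕ∞) (s : ℕ → Matrix (Fin q) (Fin q) ℂ) : Prop :=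
  match κ with
  | ⊤ => ∀ m : ℕ, KGeFin α m s
  | (m : ℕ) => KGeFin α m s

/-- The class `K^{≥,e}`: for finite `κ = m` there is a matrix `s_{m+1}` such that
`(s_j)_{j=0}^{m+1}` belongs to `K^≥`; for `κ = ∞` it is `K^≥`. -/
def KGeExt (α : ℝ) (κ : ℕ∞) (s : ℕ → Matrix (Fin q) (Fin q) ℂ) : Prop :=
  match κ with
  | ⊤ => KGe α ⊤ s
  | (m : ℕ) => ∃ A : Matrix (Fin q) (Fin q) ℂ, KGeFin α (m + 1) (Function.update s (m + 1) A)

/-- The class `K^>` for `(s_j)_{j=0}^m`, `m` finite: as `KGeFin`, with positive definite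
matrices. -/
def KGtFin (α : ℝ) (m : ℕ) (s : ℕ → Matrix (Fin q) (Fin q) ℂ) : Prop :=
  (blockHankel s (m / 2)).PosDef ∧
    (1 ≤ m → (blockHankel (shiftSeq (α : ℂ) s) ((m - 1) / 2)).PosDef)

/-- The class `K^>` for `(s_j)_{j=0}^κ`, `κ ∈ ℕ₀ ∪ {∞}`. -/
def KGt (α : ℝ) (κ : ℕ∞) (s : ℕ → Matrix (Fin q) (Fin q) ℂ) : Prop :=
  match κ with
  | ⊤ => ∀ m : ℕ, KGtFin α m s
  | (m : ℕ) => KGtFin α m s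

/-- The class `K^{≥,cd}` for `(s_j)_{j=0}^m`, `m` finite: the sequence is in `K^≥` and
`(s_j)_{j=0}^{2n}` (if `m = 2n`) resp. the shifted sequence up to `2n` (if `m = 2n + 1`) is
completely degenerate. -/
def KCDFin (α : ℝ) (m : ℕ) (s : ℕ → Matrix (Fin q) (Fin q) ℂ) : Prop :=
  KGeFin α m s ∧
    ((Even m → HankelCD (m / 2) s) ∧ (Odd m → HankelCD (m / 2) (shiftSeq (α : ℂ) s)))

/-- The class `K^{≥,cd}` for `(s_j)_{j=0}^κ`, `κ ∈ ℕ₀ ∪ {∞}`. -/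
def KCD (α : ℝ) (κ : ℕ∞) (s : ℕ → Matrix (Fin q) (Fin q) ℂ) : Prop :=
  match κ with
  | ⊤ => KGe α ⊤ s ∧ ∃ m : ℕ, KCDFin α m s
  | (m : ℕ) => KCDFin α m s

/-- The class `K^{≥,cd,m}` of the sequences `(s_j)_{j=0}^κ` in `K^≥` for which `(s_j)_{j=0}^m` is
in `K^{≥,cd}`, where `m ≤ κ`. -/
def KCDAt (α : ℝ) (m : ℕ) (κ : ℕ∞) (s : ℕ → Matrix (Fin q) (Fin q) ℂ) : Prop :=
  KGe α κ s ∧ KCDFin α m s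

end StieltjesSeq

end

open scoped Matrix ComplexOrder

noncomputable section

namespace StieltjesSeq

variable {q : ℕ}

/-! ### Moore–Penrose inverses of Hermitian matrices -/

/-! Read sequences as power series. Let `f` be the series of `s`, `u = (1 - αz) f` its
`[+,α]`-transform and `g` the reciprocal of `u`, so that the transformed sequence is `t_j =
-g_{j+1}`. Suppose first that `s_0` is invertible, so that `u g = g u = 1`. Write `T_g` for the
lower triangular block Toeplitz matrix of `g`. The Bezoutian identity `IsCornerInverse.sum_sum_mul`
says that `T_g (u_{j+k+1}) T_g^* = (-g_{j+k+1})`. Since `u_{j+1} = s^{(α)}_j`, the matrix `H_n(t)`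
is congruent to `H_n(s^{(α)})`.

The scalar factor `1 - αz` is central and can be moved: `f` and `h = (1 - αz) g` are also mutually
inverse, and `-h_{j+2} = t^{(α)}_j`. The same identity makes `H_{n+1}(s)` congruent to the block
diagonal sum of `s_0^†` and `H_n(t^{(α)})`. The two Hankel conditions thus exchange roles while the
length drops by one, which matches the definition of the classes.

For singular `s_0` everything takes place in the corner of the projection `P = s_0 s_0^†`. Replacing
`s_j` by `P s_j P` leaves `g` unchanged, and the congruences (`blockHankel_shortNegRecip`,
`blockHankel_shiftSeq_shortNegRecip`) hold for the compressed Hankel matrices. This suffices for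
non-negativity. For positive definiteness, `P = 1` and the Toeplitz factors are invertible.

Complete degeneracy means that the Hankel kernel contains a block column with last block `1`
(`schurL_eq_zero_iff`). `IsCornerInverse.exists_kernel_blockVec` carries such a column through the
congruence. -/

theorem IsMoorePenrose.conjTranspose {m n : Type*} [Fintype m] [Fintype n]
    {A : Matrix m n ℂ} {X : Matrix n m ℂ} (h : IsMoorePenrose A X) : IsMoorePenrose Aᴴ Xᴴ where
  mul_mul_left := by
    rw [← Matrix.conjTranspose_mul, ← Matrix.conjTranspose_mul, ← Matrix.mul_assoc,
      h.mul_mul_left]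
  mul_mul_right := by
    rw [← Matrix.conjTranspose_mul, ← Matrix.conjTranspose_mul, ← Matrix.mul_assoc,
      h.mul_mul_right]
  isHermitian_left := by
    rw [← Matrix.conjTranspose_mul, h.isHermitian_right, h.isHermitian_right]
  isHermitian_right := by
    rw [← Matrix.conjTranspose_mul, h.isHermitian_left, h.isHermitian_left]

theorem pinv_conjTranspose_of_isHermitian {n : Type*} [Fintype n] {A : Matrix n n ℂ}
    (hA : Aᴴ = A) : (pinv A)ᴴ = pinv A := by
  have h := (isMoorePenrose_pinv A).conjTranspose
  rw [hA] at h
  exact h.unique (isMoorePenrose_pinv A)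

theorem mul_pinv_comm_of_isHermitian {n : Type*} [Fintype n] {A : Matrix n n ℂ}
    (hA : Aᴴ = A) : A * pinv A = pinv A * A := by
  have h := (isMoorePenrose_pinv A).isHermitian_left
  rw [Matrix.conjTranspose_mul, pinv_conjTranspose_of_isHermitian hA, hA] at h
  exact h.symm

theorem pinv_zero {m n : Type*} [Fintype m] [Fintype n] :
    pinv (0 : Matrix m n ℂ) = 0 := by
  have h := (isMoorePenrose_pinv (0 : Matrix m n ℂ)).mul_mul_right
  simpa using h.symm

theorem mul_pinv_of_isUnit {n : Type*} [Fintype n] [DecidableEq n] {A : Matrix n n ℂ}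
    (hA : IsUnit A) : A * pinv A = 1 := by
  have h := (isMoorePenrose_pinv A).mul_mul_left
  exact hA.mul_right_cancel (by rw [h, one_mul])

/-- If `V^* H V = 0` for a non-negative Hermitian matrix `H`, then `H V = 0`. -/
theorem mul_eq_zero_of_posSemidef {m n : Type*} [Fintype m] [Fintype n]
    {H : Matrix m m ℂ} (hH : H.PosSemidef) {V : Matrix m n ℂ} (h : Vᴴ * (H * V) = 0) :
    H * V = 0 := by
  classical
  obtain ⟨B, rfl⟩ : ∃ B : Matrix m m ℂ, H = Bᴴ * B := by
    open scoped MatrixOrder in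
    exact CStarAlgebra.nonneg_iff_eq_star_mul_self.mp hH.nonneg
  have h1 : (B * V)ᴴ * (B * V) = 0 := by
    rw [Matrix.conjTranspose_mul, ← h]
    simp only [Matrix.mul_assoc]
  rw [Matrix.mul_assoc, Matrix.conjTranspose_mul_self_eq_zero.mp h1, Matrix.mul_zero]

/-! ### Block matrices and block columns -/

/-- The block matrix with blocks `F i j`, `0 ≤ i, j ≤ n`. -/
def blockMat (n : ℕ) (F : ℕ → ℕ → Matrix (Fin q) (Fin q) ℂ) :
    Matrix (Fin (n + 1) × Fin q) (Fin (n + 1) × Fin q) ℂ :=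
  Matrix.of fun a b => F a.1 b.1 a.2 b.2

/-- The block column with blocks `V i`, `0 ≤ i ≤ n`. -/
def blockVec (n : ℕ) (V : ℕ → Matrix (Fin q) (Fin q) ℂ) :
    Matrix (Fin (n + 1) × Fin q) (Fin q) ℂ :=
  Matrix.of fun a b => V a.1 a.2 b

theorem blockHankel_eq_blockMat (s : ℕ → Matrix (Fin q) (Fin q) ℂ) (n : ℕ) :
    blockHankel s n = blockMat n fun i j => s (i + j) := rfl

theorem blockMat_congr {n : ℕ} {F G : ℕ → ℕ → Matrix (Fin q) (Fin q) ℂ}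
    (h : ∀ i j, i ≤ n → j ≤ n → F i j = G i j) : blockMat n F = blockMat n G := by
  ext a b
  simp only [blockMat, Matrix.of_apply]
  rw [h _ _ (Nat.lt_succ_iff.mp a.1.2) (Nat.lt_succ_iff.mp b.1.2)]

theorem blockVec_congr {n : ℕ} {V W : ℕ → Matrix (Fin q) (Fin q) ℂ}
    (h : ∀ i, i ≤ n → V i = W i) : blockVec n V = blockVec n W := by
  ext a b
  simp only [blockVec, Matrix.of_apply]
  rw [h _ (Nat.lt_succ_iff.mp a.1.2)]

theorem blockMat_inj {n : ℕ} {F G : ℕ → ℕ → Matrix (Fin q) (Fin q) ℂ}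
    (h : blockMat n F = blockMat n G) {i j : ℕ} (hi : i ≤ n) (hj : j ≤ n) : F i j = G i j := by
  ext a b
  exact congrFun (congrFun h (⟨i, Nat.lt_succ_of_le hi⟩, a)) (⟨j, Nat.lt_succ_of_le hj⟩, b)

theorem blockVec_inj {n : ℕ} {V W : ℕ → Matrix (Fin q) (Fin q) ℂ}
    (h : blockVec n V = blockVec n W) {i : ℕ} (hi : i ≤ n) : V i = W i := by
  ext a b
  exact congrFun (congrFun h (⟨i, Nat.lt_succ_of_le hi⟩, a)) b

theorem blockVec_eq_zero_iff {n : ℕ} {V : ℕ → Matrix (Fin q) (Fin q) ℂ} :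
    blockVec n V = 0 ↔ ∀ i ≤ n, V i = 0 :=
  ⟨fun h _ hi => blockVec_inj (W := fun _ => 0) h hi, blockVec_congr (W := fun _ => 0)⟩

theorem blockMat_mul (n : ℕ) (F G : ℕ → ℕ → Matrix (Fin q) (Fin q) ℂ) :
    blockMat n F * blockMat n G =
      blockMat n fun i k => ∑ j ∈ Finset.range (n + 1), F i j * G j k := by
  ext a b
  simp [blockMat, Matrix.mul_apply, Fintype.sum_prod_type, Matrix.sum_apply, Finset.sum_range]

theorem blockMat_mul_blockVec (n : ℕ) (F : ℕ → ℕ → Matrix (Fin q) (Fin q) ℂ)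
    (V : ℕ → Matrix (Fin q) (Fin q) ℂ) :
    blockMat n F * blockVec n V =
      blockVec n fun i => ∑ j ∈ Finset.range (n + 1), F i j * V j := by
  ext a b
  simp [blockMat, blockVec, Matrix.mul_apply, Fintype.sum_prod_type, Matrix.sum_apply,
    Finset.sum_range]

theorem blockVec_mul (n : ℕ) (V : ℕ → Matrix (Fin q) (Fin q) ℂ) (A : Matrix (Fin q) (Fin q) ℂ) :
    blockVec n V * A = blockVec n fun i => V i * A := by
  ext a b
  simp [blockVec, Matrix.mul_apply]

theorem blockVec_add (n : ℕ) (V W : ℕ → Matrix (Fin q) (Fin q) ℂ) :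
    blockVec n V + blockVec n W = blockVec n fun i => V i + W i := rfl

theorem blockVec_conjTranspose_mul (n : ℕ) (V W : ℕ → Matrix (Fin q) (Fin q) ℂ) :
    (blockVec n V)ᴴ * blockVec n W = ∑ j ∈ Finset.range (n + 1), (V j)ᴴ * W j := by
  ext a b
  simp [blockVec, Matrix.mul_apply, Fintype.sum_prod_type, Matrix.sum_apply, Finset.sum_range]

theorem blockMat_conjTranspose (n : ℕ) (F : ℕ → ℕ → Matrix (Fin q) (Fin q) ℂ) :
    (blockMat n F)ᴴ = blockMat n fun i j => (F j i)ᴴ := rfl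

theorem blockMat_one (n : ℕ) :
    blockMat n (fun i j => if i = j then (1 : Matrix (Fin q) (Fin q) ℂ) else 0) = 1 := by
  ext ⟨i, a⟩ ⟨j, b⟩
  by_cases h : i = j
  · subst h
    simp [blockMat, Matrix.one_apply]
  · have h' : (i : ℕ) ≠ j := fun e => h (Fin.ext e)
    simp [blockMat, h, h']

/-- The free value `A` at index `n + 1` is the last block of the longer column that extends `Y`. -/
theorem exists_eq_blockVec {n : ℕ} (Y : Matrix (Fin (n + 1) × Fin q) (Fin q) ℂ)
    (A : Matrix (Fin q) (Fin q) ℂ) :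
    ∃ V : ℕ → Matrix (Fin q) (Fin q) ℂ, V (n + 1) = A ∧ Y = blockVec n V := by
  refine ⟨fun j => if h : j < n + 1 then Matrix.of fun a b => Y (⟨j, h⟩, a) b else A, ?_, ?_⟩
  · simp
  · ext a b
    simp only [blockVec, Matrix.of_apply]
    rw [dif_pos a.1.2]
    rfl

theorem blockHankel_congr {s t : ℕ → Matrix (Fin q) (Fin q) ℂ} {n : ℕ}
    (h : ∀ j ≤ 2 * n, s j = t j) : blockHankel s n = blockHankel t n :=
  blockMat_congr fun i j hi hj => h _ (by omega)

theorem blockHankel_submatrix {k n : ℕ} (h : k ≤ n) (s : ℕ → Matrix (Fin q) (Fin q) ℂ) :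
    (blockHankel s n).submatrix (Prod.map (Fin.castLE (Nat.succ_le_succ h)) id)
      (Prod.map (Fin.castLE (Nat.succ_le_succ h)) id) = blockHankel s k := rfl

theorem posSemidef_blockHankel_mono {k n : ℕ} (h : k ≤ n) {s : ℕ → Matrix (Fin q) (Fin q) ℂ}
    (hs : (blockHankel s n).PosSemidef) : (blockHankel s k).PosSemidef := by
  rw [← blockHankel_submatrix h]
  exact hs.submatrix _

theorem conjTranspose_eq_of_posSemidef_blockHankel {n : ℕ} {s : ℕ → Matrix (Fin q) (Fin q) ℂ}
    (hs : (blockHankel s n).PosSemidef) {j : ℕ} (hj : j ≤ 2 * n) : (s j)ᴴ = s j := by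
  have h := hs.isHermitian.eq
  rw [blockHankel_eq_blockMat, blockMat_conjTranspose] at h
  have h2 := blockMat_inj h (i := j / 2) (j := j - j / 2) (by omega) (by omega)
  have e1 : j - j / 2 + j / 2 = j := by omega
  have e2 : j / 2 + (j - j / 2) = j := by omega
  simpa [e1, e2] using h2

/-- In a non-negative Hermitian block Hankel matrix, the kernel of `x_{2k}` is contained in the
kernel of `x_{2k+1}`. -/
theorem mul_eq_zero_of_posSemidef_blockHankel {k : ℕ} {x : ℕ → Matrix (Fin q) (Fin q) ℂ}
    (h : (blockHankel x (k + 1)).PosSemidef) {Q : Matrix (Fin q) (Fin q) ℂ}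
    (hQ : x (2 * k) * Q = 0) : x (2 * k + 1) * Q = 0 := by
  -- For the column with single block `Q` at place `k`, the quadratic form is `Q^* x_{2k} Q = 0`;
  -- row `k + 1` of the resulting kernel equation is the claim.
  have h0 : blockHankel x (k + 1) * blockVec (k + 1) (fun i => if i = k then Q else 0) = 0 := by
    apply mul_eq_zero_of_posSemidef h
    rw [blockHankel_eq_blockMat, blockMat_mul_blockVec, blockVec_conjTranspose_mul]
    apply Finset.sum_eq_zero
    intro j _
    by_cases hj : j = k
    · subst hj
      simp [← two_mul, hQ]
    · simp [hj]
  rw [blockHankel_eq_blockMat, blockMat_mul_blockVec, blockVec_eq_zero_iff] at h0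
  have h1 := h0 (k + 1) le_rfl
  simpa [show k + 1 + k = 2 * k + 1 by omega] using h1

/-! ### Complete degeneracy -/

/-- Separates the rows over `H_n` from the last row, so that the kernel condition can be compared
with the Schur complement. -/
theorem hankel_mulVec_eq_zero_iff (s V : ℕ → Matrix (Fin q) (Fin q) ℂ) (n : ℕ)
    (hV : V (n + 1) = 1) :
    blockHankel s (n + 1) * blockVec (n + 1) V = blockVec (n + 1) (fun i =>
      if i ≤ n then (∑ j ∈ Finset.range (n + 1), s (i + j) * V j) + s (n + 1 + i)
      else blockRow s (n + 1) n * blockVec n V + s (2 * (n + 1))) := by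
  rw [blockHankel_eq_blockMat, blockMat_mul_blockVec]
  apply blockVec_congr
  intro i hi
  rw [Finset.sum_range_succ, hV, mul_one]
  split_ifs with h
  · rw [add_comm i (n + 1)]
  · obtain rfl : i = n + 1 := by omega
    rw [two_mul]
    congr 1
    ext a b
    simp [blockRow, blockVec, Matrix.mul_apply, Fintype.sum_prod_type, Matrix.sum_apply,
      Finset.sum_range]

/-- A non-negative Hermitian block Hankel matrix is completely degenerate if and only if its
kernel contains a block column with last block `1`. -/
theorem schurL_eq_zero_iff {n : ℕ} {s : ℕ → Matrix (Fin q) (Fin q) ℂ}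
    (hs : (blockHankel s n).PosSemidef) :
    schurL s n = 0 ↔ ∃ V : ℕ → Matrix (Fin q) (Fin q) ℂ,
      V n = 1 ∧ blockHankel s n * blockVec n V = 0 := by
  cases n with
  | zero =>
    constructor
    · intro h
      refine ⟨fun _ => 1, rfl, ?_⟩
      rw [blockHankel_eq_blockMat, blockMat_mul_blockVec, blockVec_eq_zero_iff]
      intro i hi
      obtain rfl : i = 0 := by omega
      simpa [schurL] using h
    · rintro ⟨V, hV, h⟩
      rw [blockHankel_eq_blockMat, blockMat_mul_blockVec, blockVec_eq_zero_iff] at h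
      simpa [hV, schurL] using h 0 le_rfl
  | succ n =>
    have hH := posSemidef_blockHankel_mono (Nat.le_succ n) hs
    have hHH : (blockHankel s n)ᴴ = blockHankel s n := hH.isHermitian.eq
    have hMP := isMoorePenrose_pinv (blockHankel s n)
    have hCB : (blockCol s (n + 1) n)ᴴ = blockRow s (n + 1) n := by
      ext a b
      have := conjTranspose_eq_of_posSemidef_blockHankel hs (j := n + 1 + b.1) (by omega)
      exact congrFun (congrFun this a) b.2
    have hB : blockCol s (n + 1) n = blockVec n fun i => s (n + 1 + i) := rfl
    simp only [schurL]
    constructor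
    · intro h
      -- The column `(-H^† B, 1)` is the candidate: its last row gives `L = 0`, and the rest of the
      -- quadratic form vanishes by `H^† H H^† = H^†`. No range inclusion is needed beforehand.
      obtain ⟨V, hV, hY⟩ := exists_eq_blockVec
        (-(pinv (blockHankel s n) * blockCol s (n + 1) n)) 1
      refine ⟨V, hV, mul_eq_zero_of_posSemidef hs ?_⟩
      have hL : blockRow s (n + 1) n * blockVec n V + s (2 * (n + 1)) = 0 := by
        rw [← hY, ← h, Matrix.mul_neg, Matrix.mul_assoc]
        abel
      rw [hankel_mulVec_eq_zero_iff s V n hV, blockVec_conjTranspose_mul,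
        Finset.sum_range_succ, if_neg (by omega), hL, mul_zero, add_zero]
      have e : ∑ j ∈ Finset.range (n + 1), (V j)ᴴ * (if j ≤ n then
          (∑ l ∈ Finset.range (n + 1), s (j + l) * V l) + s (n + 1 + j) else 0) =
          (blockVec n V)ᴴ * (blockHankel s n * blockVec n V + blockCol s (n + 1) n) := by
        rw [blockHankel_eq_blockMat, blockMat_mul_blockVec, hB, blockVec_add,
          blockVec_conjTranspose_mul]
        apply Finset.sum_congr rfl
        intro j hj
        rw [if_pos (Nat.lt_succ_iff.mp (Finset.mem_range.mp hj))]
      rw [e, ← hY, Matrix.conjTranspose_neg, Matrix.conjTranspose_mul,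
        pinv_conjTranspose_of_isHermitian hHH, Matrix.neg_mul, Matrix.mul_assoc, Matrix.mul_add,
        Matrix.mul_neg, Matrix.mul_neg, ← Matrix.mul_assoc, ← Matrix.mul_assoc,
        hMP.mul_mul_right, neg_add_cancel, Matrix.mul_zero, neg_zero]
    · rintro ⟨V, hV, h⟩
      rw [hankel_mulVec_eq_zero_iff s V n hV, blockVec_eq_zero_iff] at h
      have hbot := h (n + 1) le_rfl
      rw [if_neg (by omega)] at hbot
      have htop : blockHankel s n * blockVec n V + blockCol s (n + 1) n = 0 := by
        rw [blockHankel_eq_blockMat, blockMat_mul_blockVec, hB, blockVec_add,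
          blockVec_eq_zero_iff]
        intro i hi
        have := h i (by omega)
        rwa [if_pos hi] at this
      have hB' : blockCol s (n + 1) n = -(blockHankel s n * blockVec n V) :=
        eq_neg_of_add_eq_zero_right htop
      -- The upper rows place `B` in the range of `H`; taking adjoints, `H^† H` acts as the identity
      -- on the block row from the right.
      have hC : blockRow s (n + 1) n * pinv (blockHankel s n) * blockHankel s n =
          blockRow s (n + 1) n := by
        rw [← hCB, hB', Matrix.conjTranspose_neg, Matrix.conjTranspose_mul, hHH, Matrix.neg_mul,
          Matrix.neg_mul, Matrix.mul_assoc, Matrix.mul_assoc, ← Matrix.mul_assoc (blockHankel s n),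
          hMP.mul_mul_left]
      rw [hB', Matrix.mul_neg, ← Matrix.mul_assoc, hC, sub_neg_eq_add, add_comm, hbot]

/-! ### Reciprocal sequences in a corner of the matrix ring -/

theorem coeff_mk_mul_mk (a b : ℕ → Matrix (Fin q) (Fin q) ℂ) (j : ℕ) :
    PowerSeries.coeff j (PowerSeries.mk a * PowerSeries.mk b) =
      ∑ l ∈ Finset.range (j + 1), a l * b (j - l) := by
  simp [PowerSeries.coeff_mul, Finset.Nat.sum_antidiagonal_eq_sum_range_succ_mk]

theorem coeff_mk_mul_mk' (a b : ℕ → Matrix (Fin q) (Fin q) ℂ) (j : ℕ) :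
    PowerSeries.coeff j (PowerSeries.mk a * PowerSeries.mk b) =
      ∑ l ∈ Finset.range (j + 1), a (j - l) * b l := by
  rw [coeff_mk_mul_mk, ← Finset.sum_range_reflect]
  refine Finset.sum_congr rfl fun l hl => ?_
  have := Finset.mem_range.mp hl
  rw [show j + 1 - 1 - l = j - l by omega, show j - (j - l) = l by omega]

/-- The sequences `f` and `g` of Hermitian matrices are, as power series, inverse to each other in
the corner of the matrix ring that belongs to the orthogonal projection `P`. -/
structure IsCornerInverse (P : Matrix (Fin q) (Fin q) ℂ) (f g : ℕ → Matrix (Fin q) (Fin q) ℂ) :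
    Prop where
  conjTranspose_proj : Pᴴ = P
  mul_self : P * P = P
  mul_right : PowerSeries.mk f * PowerSeries.mk g = PowerSeries.C P
  mul_left : PowerSeries.mk g * PowerSeries.mk f = PowerSeries.C P
  proj_mul : ∀ j, P * g j = g j
  conjTranspose_left : ∀ j, (f j)ᴴ = f j
  conjTranspose_right : ∀ j, (g j)ᴴ = g j

namespace IsCornerInverse

variable {P : Matrix (Fin q) (Fin q) ℂ} {f g : ℕ → Matrix (Fin q) (Fin q) ℂ}

theorem mul_proj (h : IsCornerInverse P f g) (j : ℕ) : g j * P = g j := by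
  have := congrArg Matrix.conjTranspose (h.proj_mul j)
  rwa [Matrix.conjTranspose_mul, h.conjTranspose_right, h.conjTranspose_proj] at this

theorem sum_mul_right (h : IsCornerInverse P f g) (j : ℕ) :
    ∑ l ∈ Finset.range (j + 1), f l * g (j - l) = if j = 0 then P else 0 := by
  rw [← coeff_mk_mul_mk, h.mul_right, PowerSeries.coeff_C]

theorem sum_mul_left (h : IsCornerInverse P f g) (j : ℕ) :
    ∑ l ∈ Finset.range (j + 1), g (j - l) * f l = if j = 0 then P else 0 := by
  rw [← coeff_mk_mul_mk', h.mul_left, PowerSeries.coeff_C]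

theorem mul_zero_zero (h : IsCornerInverse P f g) : f 0 * g 0 = P := by
  simpa using h.sum_mul_right 0

/-- The Bezoutian identity for a pair of inverse power series. -/
theorem sum_sum_mul (h : IsCornerInverse P f g) (j k : ℕ) :
    ∑ i ∈ Finset.range (j + 1), g (j - i) *
      ∑ l ∈ Finset.range (k + 1), f (i + l + 1) * g (k - l) = -g (j + k + 1) := by
  induction k generalizing j with
  | zero =>
    have h1 := h.sum_mul_left (j + 1)
    rw [Finset.sum_range_succ', if_neg (by omega)] at h1
    simp only [Nat.add_sub_add_right, Nat.sub_zero] at h1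
    simp only [zero_add, Finset.sum_range_one, Nat.add_zero, Nat.sub_zero, ← mul_assoc,
      ← Finset.sum_mul]
    rw [eq_neg_of_add_eq_zero_left h1, neg_mul, mul_assoc, h.mul_zero_zero, h.mul_proj]
  | succ k ih =>
    have h1 := h.sum_mul_left (j + 1)
    rw [Finset.sum_range_succ', if_neg (by omega)] at h1
    simp only [Nat.add_sub_add_right, Nat.sub_zero] at h1
    have h2 := h.sum_mul_right (k + 1)
    rw [Finset.sum_range_succ', if_neg (by omega)] at h2
    simp only [Nat.add_sub_add_right, Nat.sub_zero] at h2
    -- The pair `(j, k + 1)` is reduced to `(j + 1, k)`, with the same sum of indices. The two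
    -- double sums share their main part, and each has one boundary contribution, equal to `-g_{j+1}
    -- f_0 g_{k+1}`.
    have h3 := ih (j + 1)
    rw [Finset.sum_range_succ'] at h3
    simp only [Nat.add_sub_add_right, Nat.sub_zero, zero_add] at h3
    rw [eq_neg_of_add_eq_zero_left h2] at h3
    have h4 : ∀ i, ∑ l ∈ Finset.range (k + 1 + 1), f (i + l + 1) * g (k + 1 - l) =
        ∑ l ∈ Finset.range (k + 1), f (i + 1 + l + 1) * g (k - l) + f (i + 1) * g (k + 1) := by
      intro i
      rw [Finset.sum_range_succ']
      simp only [Nat.add_sub_add_right, Nat.sub_zero, add_zero]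
      congr 1
      exact Finset.sum_congr rfl fun l _ => by rw [show i + (l + 1) + 1 = i + 1 + l + 1 by omega]
    simp only [h4, mul_add, Finset.sum_add_distrib]
    simp only [← mul_assoc (g _) (f _) (g (k + 1)), ← Finset.sum_mul]
    rw [eq_neg_of_add_eq_zero_left h1, show j + (k + 1) + 1 = j + 1 + k + 1 by omega, ← h3]
    noncomm_ring

theorem sum_sum_mul_zero (h : IsCornerInverse P f g) (j : ℕ) :
    ∑ i ∈ Finset.range (j + 1), g (j - i) * (f i * g 0) = if j = 0 then g 0 else 0 := by
  simp only [← mul_assoc, ← Finset.sum_mul]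
  rw [h.sum_mul_left]
  split_ifs
  · exact h.proj_mul 0
  · simp

/-- The term `i = 0` contains the coefficient of index `k + 1` of the product `f g`, which is `0`;
the remaining terms form the Bezoutian sum. -/
theorem sum_sum_mul_succ (h : IsCornerInverse P f g) (j k : ℕ) :
    ∑ i ∈ Finset.range (j + 1 + 1), g (j + 1 - i) *
      ∑ l ∈ Finset.range (k + 1 + 1), f (i + l) * g (k + 1 - l) = -g (j + k + 2) := by
  rw [Finset.sum_range_succ']
  have h2 := h.sum_mul_right (k + 1)
  rw [if_neg (by omega)] at h2
  simp only [zero_add, h2, mul_zero, add_zero, Nat.add_sub_add_right]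
  rw [show j + k + 2 = j + (k + 1) + 1 by omega, ← h.sum_sum_mul]
  refine Finset.sum_congr rfl fun i _ => ?_
  congr 1
  exact Finset.sum_congr rfl fun l _ => by rw [show i + 1 + l = i + l + 1 by omega]

end IsCornerInverse

/-! ### The `[+,α]`-transform as multiplication by `1 - αz`. -/

theorem mk_plusSeq (α : ℂ) (x : ℕ → Matrix (Fin q) (Fin q) ℂ) :
    PowerSeries.mk (plusSeq α x) =
      (1 - PowerSeries.C (α • (1 : Matrix (Fin q) (Fin q) ℂ)) * PowerSeries.X) *
        PowerSeries.mk x := by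
  ext1 j
  rw [sub_mul, one_mul, mul_assoc, map_sub, PowerSeries.coeff_C_mul]
  cases j with
  | zero => simp [plusSeq]
  | succ j =>
    rw [PowerSeries.coeff_succ_X_mul]
    simp [plusSeq, sub_eq_neg_add]

theorem mk_plusSeq_mul (α : ℂ) (x y : ℕ → Matrix (Fin q) (Fin q) ℂ) :
    PowerSeries.mk (plusSeq α x) * PowerSeries.mk y =
      PowerSeries.mk x * PowerSeries.mk (plusSeq α y) := by
  rw [mk_plusSeq, mk_plusSeq, ← mul_assoc]
  congr 1
  rw [sub_mul, mul_sub, one_mul, mul_one]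
  congr 1
  rw [mul_assoc, ← (PowerSeries.commute_X (PowerSeries.mk x)).eq, ← mul_assoc, ← mul_assoc]
  congr 1
  ext1 j
  simp [PowerSeries.coeff_C_mul, PowerSeries.coeff_mul_C]

theorem conjTranspose_plusSeq {α : ℝ} {x : ℕ → Matrix (Fin q) (Fin q) ℂ}
    (h : ∀ j, (x j)ᴴ = x j) (j : ℕ) : (plusSeq (α : ℂ) x j)ᴴ = plusSeq (α : ℂ) x j := by
  cases j <;> simp [plusSeq, h]

theorem mul_plusSeq {α : ℂ} {P : Matrix (Fin q) (Fin q) ℂ} {x : ℕ → Matrix (Fin q) (Fin q) ℂ}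
    (h : ∀ j, P * x j = x j) (j : ℕ) : P * plusSeq α x j = plusSeq α x j := by
  cases j <;> simp [plusSeq, h, mul_add]

theorem IsCornerInverse.plusSeq {α : ℝ} {P : Matrix (Fin q) (Fin q) ℂ}
    {f g : ℕ → Matrix (Fin q) (Fin q) ℂ} (h : IsCornerInverse P (plusSeq (α : ℂ) f) g)
    (hf : ∀ j, (f j)ᴴ = f j) : IsCornerInverse P f (plusSeq (α : ℂ) g) where
  conjTranspose_proj := h.conjTranspose_proj
  mul_self := h.mul_self
  mul_right := by rw [← mk_plusSeq_mul, h.mul_right]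
  mul_left := by rw [mk_plusSeq_mul, h.mul_left]
  proj_mul := mul_plusSeq h.proj_mul
  conjTranspose_left := hf
  conjTranspose_right := conjTranspose_plusSeq h.conjTranspose_right

theorem pinv_mul_recipSeq (u : ℕ → Matrix (Fin q) (Fin q) ℂ) (j : ℕ) :
    pinv (u 0) * u 0 * recipSeq u j = recipSeq u j := by
  have h := (isMoorePenrose_pinv (u 0)).mul_mul_right
  cases j with
  | zero => rw [recipSeq, h]
  | succ j => rw [recipSeq, mul_neg, ← mul_assoc, h]

/-- The recursion only makes `g` a right inverse of `u`. Since the `u_j` are Hermitian, the adjoint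
series `g^*` is a left inverse, and the two must coincide. -/
theorem recipSeq_isCornerInverse {u : ℕ → Matrix (Fin q) (Fin q) ℂ} (hu : ∀ j, (u j)ᴴ = u j)
    (hP : ∀ j, u 0 * pinv (u 0) * u j = u j) :
    IsCornerInverse (u 0 * pinv (u 0)) u (recipSeq u) := by
  have hMP := isMoorePenrose_pinv (u 0)
  have hcomm := mul_pinv_comm_of_isHermitian (hu 0)
  have hPr : ∀ j, u 0 * pinv (u 0) * recipSeq u j = recipSeq u j := fun j => by
    rw [hcomm, pinv_mul_recipSeq]
  have h1 : PowerSeries.mk u * PowerSeries.mk (recipSeq u) =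
      PowerSeries.C (u 0 * pinv (u 0)) := by
    ext1 j
    rw [coeff_mk_mul_mk', PowerSeries.coeff_C]
    cases j with
    | zero => simp [recipSeq]
    | succ j =>
      rw [Finset.sum_range_succ, if_neg (by omega), Nat.sub_self]
      rw [show recipSeq u (j + 1) = -(pinv (u 0) *
        ∑ l : Fin (j + 1), u (j + 1 - (l : ℕ)) * recipSeq u l) by rw [recipSeq]]
      rw [mul_neg, ← mul_assoc, Finset.mul_sum, ← sub_eq_add_neg, sub_eq_zero,
        Finset.sum_range]
      refine Finset.sum_congr rfl fun l _ => ?_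
      rw [← mul_assoc, hP]
  have h2 : PowerSeries.mk (fun j => (recipSeq u j)ᴴ) * PowerSeries.mk u =
      PowerSeries.C (u 0 * pinv (u 0)) := by
    ext1 j
    have h3 := congrArg Matrix.conjTranspose (congrArg (PowerSeries.coeff j) h1)
    rw [coeff_mk_mul_mk, PowerSeries.coeff_C, Matrix.conjTranspose_sum] at h3
    rw [coeff_mk_mul_mk', PowerSeries.coeff_C]
    simp only [Matrix.conjTranspose_mul, hu] at h3 ⊢
    rw [h3]
    split_ifs
    · exact hMP.isHermitian_left
    · simp
  -- Left and right inverse agree: `g^* = g^* P = g^* u g = P g = g`. This also shows that all `g_j`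
  -- are Hermitian.
  have h4 : PowerSeries.mk (fun j => (recipSeq u j)ᴴ) = PowerSeries.mk (recipSeq u) := by
    have e1 : PowerSeries.mk (fun j => (recipSeq u j)ᴴ) * PowerSeries.C (u 0 * pinv (u 0)) =
        PowerSeries.mk (fun j => (recipSeq u j)ᴴ) := by
      ext1 j
      have := congrArg Matrix.conjTranspose (hPr j)
      rw [Matrix.conjTranspose_mul, hMP.isHermitian_left] at this
      rwa [PowerSeries.coeff_mul_C, PowerSeries.coeff_mk]
    have e2 : PowerSeries.C (u 0 * pinv (u 0)) * PowerSeries.mk (recipSeq u) =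
        PowerSeries.mk (recipSeq u) := by
      ext1 j
      rw [PowerSeries.coeff_C_mul, PowerSeries.coeff_mk, hPr]
    rw [← e1, ← h1, ← mul_assoc, h2, e2]
  exact
    { conjTranspose_proj := hMP.isHermitian_left
      mul_self := by rw [← mul_assoc, hMP.mul_mul_left]
      mul_right := h1
      mul_left := by rw [← h4, h2]
      proj_mul := hPr
      conjTranspose_left := hu
      conjTranspose_right := fun j => by
        simpa using congrArg (PowerSeries.coeff j) h4 }

/-! ### Compression to the range of the first matrix -/

/-- The sequence `P s_0 P, …, P s_N P, 0, 0, …`, where `P = s_0 s_0^†`. -/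
def compressSeq (N : ℕ) (s : ℕ → Matrix (Fin q) (Fin q) ℂ) (j : ℕ) : Matrix (Fin q) (Fin q) ℂ :=
  if j ≤ N then s 0 * pinv (s 0) * s j * (s 0 * pinv (s 0)) else 0

variable {N : ℕ} {s : ℕ → Matrix (Fin q) (Fin q) ℂ}

theorem compressSeq_zero (h0 : (s 0)ᴴ = s 0) : compressSeq N s 0 = s 0 := by
  have hMP := isMoorePenrose_pinv (s 0)
  rw [compressSeq, if_pos (Nat.zero_le _), hMP.mul_mul_left, mul_pinv_comm_of_isHermitian h0,
    ← mul_assoc, hMP.mul_mul_left]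

theorem conjTranspose_compressSeq (hs : ∀ j ≤ N, (s j)ᴴ = s j) (j : ℕ) :
    (compressSeq N s j)ᴴ = compressSeq N s j := by
  have hMP := isMoorePenrose_pinv (s 0)
  unfold compressSeq
  split_ifs with h
  · rw [Matrix.conjTranspose_mul, hMP.isHermitian_left, Matrix.conjTranspose_mul,
      hMP.isHermitian_left, hs j h, ← mul_assoc, ← mul_assoc, mul_assoc (_ * s j)]
  · simp

theorem mul_compressSeq (j : ℕ) :
    s 0 * pinv (s 0) * compressSeq N s j = compressSeq N s j := by
  have hMP := isMoorePenrose_pinv (s 0)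
  unfold compressSeq
  split_ifs with h
  · simp only [← mul_assoc]
    rw [hMP.mul_mul_left]
  · simp

theorem plusSeq_compressSeq (α : ℂ) {j : ℕ} (hj : j ≤ N) :
    plusSeq α (compressSeq N s) j =
      s 0 * pinv (s 0) * plusSeq α s j * (s 0 * pinv (s 0)) := by
  cases j with
  | zero => simp [plusSeq, compressSeq]
  | succ j =>
    simp [plusSeq, compressSeq, hj, (Nat.le_succ j).trans hj, mul_add, add_mul]

/-- The projections inserted by the compression are absorbed in the recursion by `s_0^† P = s_0^†`
on the left and `P g_l = g_l` on the right. -/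
theorem recipSeq_plusSeq_compressSeq (α : ℂ) (h0 : (s 0)ᴴ = s 0) {j : ℕ} (hj : j ≤ N) :
    recipSeq (plusSeq α (compressSeq N s)) j = recipSeq (plusSeq α s) j := by
  have hMP := isMoorePenrose_pinv (s 0)
  have e0 : plusSeq α (compressSeq N s) 0 = s 0 := compressSeq_zero h0
  induction j using Nat.strong_induction_on with
  | _ j ih =>
    cases j with
    | zero => rw [recipSeq, recipSeq, e0, plusSeq]
    | succ j =>
      rw [recipSeq, recipSeq, e0, show plusSeq α s 0 = s 0 from rfl, Finset.mul_sum,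
        Finset.mul_sum]
      congr 1
      refine Finset.sum_congr rfl fun l _ => ?_
      rw [ih l l.2 (by omega), plusSeq_compressSeq α (by omega)]
      have h1 : s 0 * pinv (s 0) * recipSeq (plusSeq α s) l = recipSeq (plusSeq α s) l := by
        rw [mul_pinv_comm_of_isHermitian h0]
        exact pinv_mul_recipSeq (plusSeq α s) l
      have h2 : pinv (s 0) * (s 0 * pinv (s 0)) = pinv (s 0) := by
        rw [← mul_assoc, hMP.mul_mul_right]
      rw [mul_assoc _ (s 0 * pinv (s 0)), h1, mul_assoc _ (plusSeq α s _), ← mul_assoc (pinv (s 0)),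
        h2]

theorem isCornerInverse_recipSeq_plusSeq (α : ℝ) (hs : ∀ j ≤ N, (s j)ᴴ = s j) :
    IsCornerInverse (s 0 * pinv (s 0)) (plusSeq (α : ℂ) (compressSeq N s))
      (recipSeq (plusSeq (α : ℂ) (compressSeq N s))) := by
  have e0 : plusSeq (α : ℂ) (compressSeq N s) 0 = s 0 := compressSeq_zero (hs 0 (Nat.zero_le _))
  have h := recipSeq_isCornerInverse (u := plusSeq (α : ℂ) (compressSeq N s))
    (conjTranspose_plusSeq (conjTranspose_compressSeq hs))
  rw [e0] at h
  exact h (mul_plusSeq mul_compressSeq)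

theorem isCornerInverse_compressSeq (α : ℝ) (hs : ∀ j ≤ N, (s j)ᴴ = s j) :
    IsCornerInverse (s 0 * pinv (s 0)) (compressSeq N s)
      (plusSeq (α : ℂ) (recipSeq (plusSeq (α : ℂ) (compressSeq N s)))) :=
  (isCornerInverse_recipSeq_plusSeq α hs).plusSeq (conjTranspose_compressSeq hs)

/-! ### Congruences between block Hankel matrices -/

/-- The blocks of the lower triangular block Toeplitz matrix of a sequence. -/
def toeplitz (x : ℕ → Matrix (Fin q) (Fin q) ℂ) (i j : ℕ) : Matrix (Fin q) (Fin q) ℂ :=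
  if j ≤ i then x (i - j) else 0

/-- The block diagonal matrix with diagonal blocks `P`. -/
def blockDiag (n : ℕ) (P : Matrix (Fin q) (Fin q) ℂ) :
    Matrix (Fin (n + 1) × Fin q) (Fin (n + 1) × Fin q) ℂ :=
  blockMat n fun i j => if i = j then P else 0

theorem blockDiag_one (n : ℕ) : blockDiag n (1 : Matrix (Fin q) (Fin q) ℂ) = 1 := blockMat_one n

theorem blockDiag_mul_blockVec (n : ℕ) (P : Matrix (Fin q) (Fin q) ℂ)
    (V : ℕ → Matrix (Fin q) (Fin q) ℂ) :
    blockDiag n P * blockVec n V = blockVec n fun i => P * V i := by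
  rw [blockDiag, blockMat_mul_blockVec]
  refine blockVec_congr fun i hi => ?_
  simp only [ite_mul, zero_mul, Finset.sum_ite_eq, Finset.mem_range]
  rw [if_pos (Nat.lt_succ_of_le hi)]

theorem blockDiag_mul_blockMat_mul_blockDiag (n : ℕ) (P : Matrix (Fin q) (Fin q) ℂ)
    (F : ℕ → ℕ → Matrix (Fin q) (Fin q) ℂ) :
    blockDiag n P * blockMat n F * blockDiag n P = blockMat n fun i j => P * F i j * P := by
  rw [blockDiag, blockMat_mul, blockMat_mul]
  refine blockMat_congr fun i j hi hj => ?_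
  simp only [ite_mul, zero_mul, mul_ite, mul_zero, Finset.sum_ite_eq, Finset.sum_ite_eq',
    Finset.mem_range]
  rw [if_pos (Nat.lt_succ_of_le hi), if_pos (Nat.lt_succ_of_le hj)]

theorem conjTranspose_blockDiag {n : ℕ} {P : Matrix (Fin q) (Fin q) ℂ} (hP : Pᴴ = P) :
    (blockDiag n P)ᴴ = blockDiag n P := by
  rw [blockDiag, blockMat_conjTranspose]
  refine blockMat_congr fun i j _ _ => ?_
  by_cases h : i = j
  · simp [h, hP]
  · simp [h, Ne.symm h]

theorem sum_range_mul_ite_le {R : Type*} [NonUnitalNonAssocSemiring R] (F G : ℕ → R) {k n : ℕ}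
    (hk : k ≤ n) : ∑ l ∈ Finset.range (n + 1), F l * (if l ≤ k then G l else 0) =
      ∑ l ∈ Finset.range (k + 1), F l * G l := by
  rw [← Finset.sum_subset (Finset.range_mono (Nat.succ_le_succ hk))]
  · exact Finset.sum_congr rfl fun l hl => by
      rw [if_pos (Nat.lt_succ_iff.mp (Finset.mem_range.mp hl))]
  · intro l _ hl
    rw [if_neg (fun h => hl (Finset.mem_range.mpr (Nat.lt_succ_of_le h))), mul_zero]

theorem sum_range_ite_le_mul {R : Type*} [NonUnitalNonAssocSemiring R] (F G : ℕ → R) {k n : ℕ}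
    (hk : k ≤ n) : ∑ l ∈ Finset.range (n + 1), (if l ≤ k then G l else 0) * F l =
      ∑ l ∈ Finset.range (k + 1), G l * F l := by
  rw [← Finset.sum_subset (Finset.range_mono (Nat.succ_le_succ hk))]
  · exact Finset.sum_congr rfl fun l hl => by
      rw [if_pos (Nat.lt_succ_iff.mp (Finset.mem_range.mp hl))]
  · intro l _ hl
    rw [if_neg (fun h => hl (Finset.mem_range.mpr (Nat.lt_succ_of_le h))), zero_mul]

theorem toeplitz_mul_mul_conjTranspose {g : ℕ → Matrix (Fin q) (Fin q) ℂ}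
    (hg : ∀ j, (g j)ᴴ = g j) (n : ℕ) (F : ℕ → ℕ → Matrix (Fin q) (Fin q) ℂ) :
    blockMat n (toeplitz g) * blockMat n F * (blockMat n (toeplitz g))ᴴ =
      blockMat n fun j k => ∑ i ∈ Finset.range (j + 1), g (j - i) *
        ∑ l ∈ Finset.range (k + 1), F i l * g (k - l) := by
  rw [blockMat_conjTranspose, mul_assoc, blockMat_mul, blockMat_mul]
  refine blockMat_congr fun j k hj hk => ?_
  simp only [toeplitz]
  rw [sum_range_ite_le_mul _ (fun i => g (j - i)) hj]
  refine Finset.sum_congr rfl fun i _ => ?_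
  congr 1
  rw [← sum_range_mul_ite_le (F i) (fun l => g (k - l)) hk]
  refine Finset.sum_congr rfl fun l _ => ?_
  split_ifs <;> simp [hg]

namespace IsCornerInverse

variable {P : Matrix (Fin q) (Fin q) ℂ} {f g : ℕ → Matrix (Fin q) (Fin q) ℂ}

theorem toeplitz_mul_toeplitz (h : IsCornerInverse P f g) (n : ℕ) :
    blockMat n (toeplitz f) * blockMat n (toeplitz g) = blockDiag n P := by
  rw [blockMat_mul, blockDiag]
  refine blockMat_congr fun i k hi hk => ?_
  simp only [toeplitz]
  rw [sum_range_ite_le_mul _ (fun j => f (i - j)) hi]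
  by_cases hik : k ≤ i
  · have e : Finset.Ico k (i + 1) ⊆ Finset.range (i + 1) := fun x hx =>
      Finset.mem_range.mpr (Finset.mem_Ico.mp hx).2
    rw [← Finset.sum_subset e, Finset.sum_Ico_eq_sum_range, show i + 1 - k = i - k + 1 by omega]
    · have h1 : PowerSeries.coeff (i - k) (PowerSeries.mk f * PowerSeries.mk g) =
          if i = k then P else 0 := by
        rw [h.mul_right, PowerSeries.coeff_C]
        exact if_congr (by omega) rfl rfl
      rw [← h1, coeff_mk_mul_mk']
      refine Finset.sum_congr rfl fun l _ => ?_
      rw [if_pos (Nat.le_add_right k l), Nat.add_sub_cancel_left, Nat.sub_add_eq]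
    · intro x hx hx'
      rw [if_neg, mul_zero]
      intro hkx
      exact hx' (Finset.mem_Ico.mpr ⟨hkx, Finset.mem_range.mp hx⟩)
  · rw [if_neg (by omega)]
    refine Finset.sum_eq_zero fun j hj => ?_
    have := Finset.mem_range.mp hj
    rw [if_neg (by omega), mul_zero]

/-- A block column in the kernel of a block Hankel matrix, with last block `1`, gives rise to such
a block column for the congruent matrix. -/
theorem exists_kernel_blockVec (h : IsCornerInverse P f g) {S : Matrix (Fin q) (Fin q) ℂ}
    (hfS : f 0 * S = P) (hPS : P * S = S) {n : ℕ} {x V : ℕ → Matrix (Fin q) (Fin q) ℂ}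
    (hx : ∀ j < 2 * n, x j * P = x j) (hV : V n = 1)
    (hxV : blockHankel x n * blockVec n V = 0) :
    ∃ W : ℕ → Matrix (Fin q) (Fin q) ℂ, W n = 1 ∧
      blockMat n (toeplitz g) * (blockDiag n P * blockHankel x n * blockDiag n P) *
        (blockMat n (toeplitz g))ᴴ * blockVec n W = 0 := by
  -- With `V` the given column, the witness is `W = T_f^* V S + E`. Its last block is `f_0 S + (1 -
  -- P) = 1`, and `T_g^*` annihilates the correction `E` because `g_j P = g_j`.
  set E : ℕ → Matrix (Fin q) (Fin q) ℂ := fun l => if l = n then 1 - P else 0 with hE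
  refine ⟨fun l => (∑ j ∈ Finset.range (n + 1), (toeplitz f j l)ᴴ * V j) * S + E l, ?_, ?_⟩
  · beta_reduce
    rw [Finset.sum_range_succ, Finset.sum_eq_zero]
    · simp [toeplitz, hV, h.conjTranspose_left, hfS, hE]
    · intro j hj
      have := Finset.mem_range.mp hj
      simp [toeplitz, Nat.not_le.mpr this]
  · have hW : blockVec n (fun l =>
        (∑ j ∈ Finset.range (n + 1), (toeplitz f j l)ᴴ * V j) * S + E l) =
        (blockMat n (toeplitz f))ᴴ * blockVec n V * S + blockVec n E := by
      rw [blockMat_conjTranspose, blockMat_mul_blockVec, blockVec_mul, blockVec_add]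
    have hgE : (blockMat n (toeplitz g))ᴴ * blockVec n E = 0 := by
      rw [blockMat_conjTranspose, blockMat_mul_blockVec, blockVec_eq_zero_iff]
      intro i hi
      refine Finset.sum_eq_zero fun j _ => ?_
      by_cases hj : j = n
      · simp [hE, hj, toeplitz, hi, h.conjTranspose_right, mul_sub, h.mul_proj]
      · simp [hE, hj]
    have hfg : (blockMat n (toeplitz g))ᴴ * (blockMat n (toeplitz f))ᴴ = blockDiag n P := by
      rw [← Matrix.conjTranspose_mul, h.toeplitz_mul_toeplitz,
        conjTranspose_blockDiag h.conjTranspose_proj]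
    have hker : blockHankel x n * (blockDiag n P * (blockDiag n P * (blockVec n V * S))) = 0 := by
      rw [blockVec_mul, blockDiag_mul_blockVec, blockDiag_mul_blockVec]
      simp only [← mul_assoc, h.mul_self]
      rw [blockHankel_eq_blockMat, blockMat_mul_blockVec, blockVec_eq_zero_iff] at hxV ⊢
      intro i hi
      rw [← zero_mul S, ← hxV i hi, Finset.sum_mul]
      refine Finset.sum_congr rfl fun j hj => ?_
      have := Finset.mem_range.mp hj
      -- The corner entry `x_{2n}` need not satisfy `x_{2n} P = x_{2n}`; there `V_n = 1` and `P S =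
      -- S` are used instead.
      by_cases hij : i + j < 2 * n
      · rw [← mul_assoc, ← mul_assoc, hx _ hij]
      · obtain rfl : j = n := by omega
        rw [hV, mul_one, hPS, mul_one]
    calc _ = blockMat n (toeplitz g) * (blockDiag n P * (blockHankel x n * (blockDiag n P *
          ((blockMat n (toeplitz g))ᴴ * ((blockMat n (toeplitz f))ᴴ * (blockVec n V * S)) +
            (blockMat n (toeplitz g))ᴴ * blockVec n E)))) := by
          rw [hW]
          simp only [Matrix.mul_assoc, Matrix.mul_add]
      _ = 0 := by
        rw [hgE, add_zero, ← Matrix.mul_assoc (blockMat n (toeplitz g))ᴴ, hfg, hker,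
          Matrix.mul_zero, Matrix.mul_zero]

end IsCornerInverse

theorem shortNegRecip_eq_of_compressSeq (α : ℂ) (h0 : (s 0)ᴴ = s 0) {j : ℕ} (hj : j + 1 ≤ N) :
    shortNegRecip α s j = -recipSeq (plusSeq α (compressSeq N s)) (j + 1) := by
  rw [recipSeq_plusSeq_compressSeq α h0 hj, shortNegRecip]

/-- The Hankel matrix of the transformed sequence is congruent to the compressed Hankel matrix of
the shifted sequence. -/
theorem blockHankel_shortNegRecip (α : ℝ) (hs : ∀ j ≤ N, (s j)ᴴ = s j) {n : ℕ}
    (hn : 2 * n + 1 ≤ N) :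
    blockHankel (shortNegRecip (α : ℂ) s) n =
      blockMat n (toeplitz (recipSeq (plusSeq (α : ℂ) (compressSeq N s)))) *
        (blockDiag n (s 0 * pinv (s 0)) * blockHankel (shiftSeq (α : ℂ) s) n *
          blockDiag n (s 0 * pinv (s 0))) *
        (blockMat n (toeplitz (recipSeq (plusSeq (α : ℂ) (compressSeq N s)))))ᴴ := by
  have h := isCornerInverse_recipSeq_plusSeq α hs
  rw [blockHankel_eq_blockMat (shiftSeq _ _), blockHankel_eq_blockMat, blockDiag_mul_blockMat_mul_blockDiag,
    blockMat_congr (F := fun i j => s 0 * pinv (s 0) * shiftSeq (α : ℂ) s (i + j) *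
      (s 0 * pinv (s 0))) (G := fun i j => plusSeq (α : ℂ) (compressSeq N s) (i + j + 1)),
    toeplitz_mul_mul_conjTranspose h.conjTranspose_right]
  · refine blockMat_congr fun j k hj hk => ?_
    rw [h.sum_sum_mul]
    exact shortNegRecip_eq_of_compressSeq (α : ℂ) (hs 0 (Nat.zero_le _)) (by omega)
  · intro i j hi hj
    rw [plusSeq_compressSeq _ (by omega)]
    rfl

/-- The compressed Hankel matrix of a sequence is congruent to the block diagonal sum of `s_0^†`
and the Hankel matrix of the shifted transformed sequence. -/
theorem blockHankel_shiftSeq_shortNegRecip (α : ℝ) (hs : ∀ j ≤ N, (s j)ᴴ = s j) {n : ℕ}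
    (hn : 2 * n + 2 ≤ N) :
    blockMat (n + 1) (toeplitz (plusSeq (α : ℂ) (recipSeq (plusSeq (α : ℂ) (compressSeq N s))))) *
        (blockDiag (n + 1) (s 0 * pinv (s 0)) * blockHankel s (n + 1) *
          blockDiag (n + 1) (s 0 * pinv (s 0))) *
        (blockMat (n + 1)
          (toeplitz (plusSeq (α : ℂ) (recipSeq (plusSeq (α : ℂ) (compressSeq N s))))))ᴴ =
      blockMat (n + 1) fun i j => if i = 0 ∨ j = 0 then (if i = 0 ∧ j = 0 then pinv (s 0) else 0)
        else shiftSeq (α : ℂ) (shortNegRecip (α : ℂ) s) (i - 1 + (j - 1)) := by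
  have h := isCornerInverse_compressSeq α hs
  have h0 := hs 0 (Nat.zero_le _)
  have hg0 : plusSeq (α : ℂ) (recipSeq (plusSeq (α : ℂ) (compressSeq N s))) 0 = pinv (s 0) := by
    simp only [plusSeq, recipSeq, compressSeq_zero h0]
  -- The transformed matrix is Hermitian, so its first block row follows from its first block
  -- column.
  have hsym : ∀ {g : ℕ → Matrix (Fin q) (Fin q) ℂ} {F : ℕ → Matrix (Fin q) (Fin q) ℂ},
      (∀ j, (g j)ᴴ = g j) → (∀ j, (F j)ᴴ = F j) → ∀ j k,
      (∑ i ∈ Finset.range (j + 1), g (j - i) *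
        ∑ l ∈ Finset.range (k + 1), F (i + l) * g (k - l))ᴴ =
      ∑ i ∈ Finset.range (k + 1), g (k - i) *
        ∑ l ∈ Finset.range (j + 1), F (i + l) * g (j - l) := by
    intro g F hg hF j k
    simp only [Matrix.conjTranspose_sum, Matrix.conjTranspose_mul, hg, hF, Finset.mul_sum]
    rw [Finset.sum_comm]
    refine Finset.sum_congr rfl fun i _ => Finset.sum_congr rfl fun l _ => ?_
    rw [mul_assoc, add_comm]
  rw [blockHankel_eq_blockMat, blockDiag_mul_blockMat_mul_blockDiag,
    blockMat_congr (F := fun i j => s 0 * pinv (s 0) * s (i + j) * (s 0 * pinv (s 0)))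
      (G := fun i j => compressSeq N s (i + j)),
    toeplitz_mul_mul_conjTranspose h.conjTranspose_right]
  · refine blockMat_congr fun j k hj hk => ?_
    have hcol : ∀ j, ∑ i ∈ Finset.range (j + 1),
        plusSeq (α : ℂ) (recipSeq (plusSeq (α : ℂ) (compressSeq N s))) (j - i) *
        ∑ l ∈ Finset.range (0 + 1), compressSeq N s (i + l) *
          plusSeq (α : ℂ) (recipSeq (plusSeq (α : ℂ) (compressSeq N s))) (0 - l) =
        if j = 0 then pinv (s 0) else 0 := by
      intro j
      have := h.sum_sum_mul_zero j
      rw [hg0] at this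
      rw [← this]
      simp [hg0]
    cases k with
    | zero =>
      rw [hcol]
      simp
    | succ k =>
      cases j with
      | zero =>
        rw [← hsym h.conjTranspose_right h.conjTranspose_left, hcol]
        simp
      | succ j =>
        rw [h.sum_sum_mul_succ]
        simp only [Nat.add_eq_zero_iff, one_ne_zero, and_false, or_self, if_false,
          Nat.add_sub_cancel, shiftSeq, plusSeq]
        rw [shortNegRecip_eq_of_compressSeq (N := N) (α : ℂ) h0 (by omega),
          shortNegRecip_eq_of_compressSeq (N := N) (α : ℂ) h0 (by omega)]
        simp [add_comm]
  · intro i j hi hj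
    rw [compressSeq, if_pos (by omega)]

theorem blockHankel_shiftSeq_shortNegRecip_eq_submatrix (α : ℝ) (hs : ∀ j ≤ N, (s j)ᴴ = s j)
    {n : ℕ} (hn : 2 * n + 2 ≤ N) :
    blockHankel (shiftSeq (α : ℂ) (shortNegRecip (α : ℂ) s)) n =
      (blockMat (n + 1)
          (toeplitz (plusSeq (α : ℂ) (recipSeq (plusSeq (α : ℂ) (compressSeq N s))))) *
        (blockDiag (n + 1) (s 0 * pinv (s 0)) * blockHankel s (n + 1) *
          blockDiag (n + 1) (s 0 * pinv (s 0))) *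
        (blockMat (n + 1)
          (toeplitz (plusSeq (α : ℂ) (recipSeq (plusSeq (α : ℂ) (compressSeq N s))))))ᴴ).submatrix
        (Prod.map Fin.succ id) (Prod.map Fin.succ id) := by
  rw [blockHankel_shiftSeq_shortNegRecip α hs hn]
  ext a b
  simp [blockHankel, blockMat]

/-! ### The transform of finite sequences -/

variable {α : ℝ} {m : ℕ}

theorem shiftSeq_congr (α : ℂ) {s t : ℕ → Matrix (Fin q) (Fin q) ℂ} {m : ℕ}
    (h : ∀ j ≤ m + 1, s j = t j) {j : ℕ} (hj : j ≤ m) : shiftSeq α s j = shiftSeq α t j := by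
  rw [shiftSeq, shiftSeq, h j (by omega), h (j + 1) (by omega)]

theorem recipSeq_congr {s t : ℕ → Matrix (Fin q) (Fin q) ℂ} {m : ℕ}
    (h : ∀ j ≤ m, s j = t j) {j : ℕ} (hj : j ≤ m) : recipSeq s j = recipSeq t j := by
  induction j using Nat.strong_induction_on with
  | _ j ih =>
    cases j with
    | zero => rw [recipSeq, recipSeq, h 0 hj]
    | succ j =>
      rw [recipSeq, recipSeq, h 0 (Nat.zero_le _)]
      congr 2
      refine Finset.sum_congr rfl fun l _ => ?_
      rw [ih l l.2 (by omega), h _ (by omega)]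

theorem plusSeq_congr (α : ℂ) {s t : ℕ → Matrix (Fin q) (Fin q) ℂ} {m : ℕ}
    (h : ∀ j ≤ m, s j = t j) {j : ℕ} (hj : j ≤ m) : plusSeq α s j = plusSeq α t j := by
  cases j with
  | zero => exact h 0 hj
  | succ j => rw [plusSeq, plusSeq, h j (by omega), h (j + 1) hj]

theorem shortNegRecip_congr (α : ℂ) {s t : ℕ → Matrix (Fin q) (Fin q) ℂ} {m : ℕ}
    (h : ∀ j ≤ m + 1, s j = t j) {j : ℕ} (hj : j ≤ m) :
    shortNegRecip α s j = shortNegRecip α t j := by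
  rw [shortNegRecip, shortNegRecip,
    recipSeq_congr (fun _ => plusSeq_congr α h) (Nat.succ_le_succ hj)]

theorem KGeFin.congr {t : ℕ → Matrix (Fin q) (Fin q) ℂ} (hs : KGeFin α m s)
    (h : ∀ j ≤ m, s j = t j) : KGeFin α m t := by
  refine ⟨?_, fun hm => ?_⟩
  · rw [← blockHankel_congr fun j hj => h j (by omega)]
    exact hs.1
  · rw [← blockHankel_congr fun j hj =>
      shiftSeq_congr (m := m - 1) _ (fun i hi => h i (by omega)) (by omega)]
    exact hs.2 hm

/-- For odd `m` the last matrix `s_m` occurs only in the shifted Hankel matrix; it is Hermitian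
since `α` is real and `s_{m-1}` is Hermitian. -/
theorem KGeFin.conjTranspose_eq (hs : KGeFin α m s) {j : ℕ} (hj : j ≤ m) : (s j)ᴴ = s j := by
  by_cases h : j ≤ 2 * (m / 2)
  · exact conjTranspose_eq_of_posSemidef_blockHankel hs.1 h
  · have h1 := conjTranspose_eq_of_posSemidef_blockHankel (hs.2 (by omega)) (j := j - 1)
      (by omega)
    have h2 := conjTranspose_eq_of_posSemidef_blockHankel hs.1 (j := j - 1) (by omega)
    have e : j - 1 + 1 = j := by omega
    simpa [shiftSeq, h2, e] using h1

/-- The kernel of `s_0` is passed on step by step: from `s_{2k}` to `s_{2k+1}` through the Hankel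
matrix of `s`, then to `s_{2k+2}` through that of the shifted sequence. Each step needs one further
matrix, so the last one, `s_{m+1}`, is not reached. -/
theorem KGeFin.mul_proj (hs : KGeFin α (m + 1) s) {j : ℕ} (hj : j ≤ m) :
    s j * (s 0 * pinv (s 0)) = s j := by
  have h0 := hs.conjTranspose_eq (Nat.zero_le _)
  have key : ∀ j ≤ m, s j * (1 - s 0 * pinv (s 0)) = 0 := by
    intro j
    induction j using Nat.strong_induction_on with
    | _ j ih =>
      intro hj
      rcases Nat.eq_zero_or_pos j with rfl | hpos
      · rw [mul_sub, mul_one, mul_pinv_comm_of_isHermitian h0, ← mul_assoc,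
          (isMoorePenrose_pinv (s 0)).mul_mul_left, sub_self]
      · obtain ⟨k, rfl | rfl⟩ : ∃ k, j = 2 * k + 1 ∨ j = 2 * k + 2 :=
          ⟨(j - 1) / 2, by omega⟩
        · exact mul_eq_zero_of_posSemidef_blockHankel
            (posSemidef_blockHankel_mono (by omega) hs.1) (ih (2 * k) (by omega) (by omega))
        · have h1 := ih (2 * k) (by omega) (by omega)
          have h2 := ih (2 * k + 1) (by omega) (by omega)
          have h3 := mul_eq_zero_of_posSemidef_blockHankel (x := shiftSeq (α : ℂ) s) (k := k)
            (posSemidef_blockHankel_mono (by omega) (hs.2 (by omega)))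
            (Q := 1 - s 0 * pinv (s 0)) (by
              rw [shiftSeq, add_mul, neg_mul, smul_mul_assoc, h1, h2, smul_zero, neg_zero,
                add_zero])
          rwa [shiftSeq, add_mul, neg_mul, smul_mul_assoc, h2, smul_zero, neg_zero,
            zero_add] at h3
  have := key j hj
  rw [mul_sub, mul_one, sub_eq_zero] at this
  exact this.symm

theorem posSemidef_blockDiag_mul_mul {n : ℕ} {P : Matrix (Fin q) (Fin q) ℂ} (hP : Pᴴ = P)
    {H : Matrix (Fin (n + 1) × Fin q) (Fin (n + 1) × Fin q) ℂ} (hH : H.PosSemidef) :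
    (blockDiag n P * H * blockDiag n P).PosSemidef := by
  have := hH.mul_mul_conjTranspose_same (blockDiag n P)
  rwa [conjTranspose_blockDiag hP] at this

theorem KGeFin.shortNegRecip (hs : KGeFin α (m + 1) s) :
    KGeFin α m (shortNegRecip (α : ℂ) s) := by
  have hherm : ∀ j ≤ m + 1, (s j)ᴴ = s j := fun j => hs.conjTranspose_eq
  have hP := (isMoorePenrose_pinv (s 0)).isHermitian_left
  refine ⟨?_, fun hm => ?_⟩
  · rw [blockHankel_shortNegRecip α hherm (by omega)]
    exact (posSemidef_blockDiag_mul_mul hP (hs.2 (by omega))).mul_mul_conjTranspose_same _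
  · rw [blockHankel_shiftSeq_shortNegRecip_eq_submatrix α hherm (by omega)]
    exact ((posSemidef_blockDiag_mul_mul hP
      (posSemidef_blockHankel_mono (by omega) hs.1)).mul_mul_conjTranspose_same _).submatrix _

/-! ### Positive definite sequences. -/

theorem KGtFin.kGeFin (hs : KGtFin α m s) : KGeFin α m s :=
  ⟨hs.1.posSemidef, fun hm => (hs.2 hm).posSemidef⟩

theorem posDef_blockHankel_mono {k n : ℕ} (h : k ≤ n) (hs : (blockHankel s n).PosDef) :
    (blockHankel s k).PosDef := by
  rw [← blockHankel_submatrix h]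
  exact hs.submatrix (Function.Injective.prodMap (Fin.castLE_injective _) Function.injective_id)

theorem KGtFin.mul_pinv_eq_one (hs : KGtFin α m s) : s 0 * pinv (s 0) = 1 := by
  have h0 := posDef_blockHankel_mono (Nat.zero_le _) hs.1
  have h1 := h0.submatrix (e := fun i : Fin q => ((0 : Fin 1), i))
    fun i j h => (Prod.ext_iff.mp h).2
  exact mul_pinv_of_isUnit (A := s 0) h1.isUnit

theorem IsCornerInverse.isUnit_toeplitz {f g : ℕ → Matrix (Fin q) (Fin q) ℂ}
    (h : IsCornerInverse 1 f g) (n : ℕ) : IsUnit (blockMat n (toeplitz g)) := by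
  have := h.toeplitz_mul_toeplitz n
  rw [blockDiag_one] at this
  exact IsUnit.of_mul_eq_one_right _ this

theorem KGtFin.shortNegRecip (hs : KGtFin α (m + 1) s) :
    KGtFin α m (shortNegRecip (α : ℂ) s) := by
  have hherm : ∀ j ≤ m + 1, (s j)ᴴ = s j := fun j => hs.kGeFin.conjTranspose_eq
  have hP := hs.mul_pinv_eq_one
  have hu := isCornerInverse_recipSeq_plusSeq α hherm
  have hf := isCornerInverse_compressSeq α hherm
  rw [hP] at hu hf
  refine ⟨?_, fun hm => ?_⟩
  · rw [blockHankel_shortNegRecip α hherm (by omega), hP, blockDiag_one, one_mul, mul_one]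
    exact (Matrix.IsUnit.posDef_star_right_conjugate_iff (hu.isUnit_toeplitz _)).mpr
      (hs.2 (by omega))
  · rw [blockHankel_shiftSeq_shortNegRecip_eq_submatrix α hherm (by omega), hP, blockDiag_one,
      one_mul, mul_one]
    exact ((Matrix.IsUnit.posDef_star_right_conjugate_iff (hf.isUnit_toeplitz _)).mpr
      (posDef_blockHankel_mono (by omega) hs.1)).submatrix
      (Function.Injective.prodMap (Fin.succ_injective _) Function.injective_id)

/-! ### Transport of complete degeneracy. -/

theorem schurL_shortNegRecip_eq_zero {n : ℕ} (hs : KGeFin α (2 * n + 1) s)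
    (hL : schurL (shiftSeq (α : ℂ) s) n = 0) : schurL (shortNegRecip (α : ℂ) s) n = 0 := by
  have hherm : ∀ j ≤ 2 * n + 1, (s j)ᴴ = s j := fun j => hs.conjTranspose_eq
  have hH : (blockHankel (shiftSeq (α : ℂ) s) n).PosSemidef :=
    posSemidef_blockHankel_mono (by omega) (hs.2 (by omega))
  obtain ⟨V, hV, hker⟩ := (schurL_eq_zero_iff hH).mp hL
  have hMP := isMoorePenrose_pinv (s 0)
  have hcomm := mul_pinv_comm_of_isHermitian (hherm 0 (Nat.zero_le _))
  have h := isCornerInverse_recipSeq_plusSeq α hherm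
  obtain ⟨W, hW, hW0⟩ := h.exists_kernel_blockVec (S := pinv (s 0))
    (by rw [plusSeq, compressSeq_zero (hherm 0 (Nat.zero_le _))])
    (by rw [hcomm, hMP.mul_mul_right])
    (fun j hj => by
      rw [shiftSeq, add_mul, neg_mul, smul_mul_assoc, hs.mul_proj (by omega),
        hs.mul_proj (by omega)]) hV hker
  rw [← blockHankel_shortNegRecip α hherm le_rfl] at hW0
  refine (schurL_eq_zero_iff ?_).mpr ⟨W, hW, hW0⟩
  exact posSemidef_blockHankel_mono (by omega) hs.shortNegRecip.1

theorem schurL_shiftSeq_shortNegRecip_eq_zero {n : ℕ} (hs : KGeFin α (2 * n + 2) s)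
    (hL : schurL s (n + 1) = 0) :
    schurL (shiftSeq (α : ℂ) (shortNegRecip (α : ℂ) s)) n = 0 := by
  have hherm : ∀ j ≤ 2 * n + 2, (s j)ᴴ = s j := fun j => hs.conjTranspose_eq
  have hH : (blockHankel s (n + 1)).PosSemidef := posSemidef_blockHankel_mono (by omega) hs.1
  obtain ⟨V, hV, hker⟩ := (schurL_eq_zero_iff hH).mp hL
  have hMP := isMoorePenrose_pinv (s 0)
  have hcomm := mul_pinv_comm_of_isHermitian (hherm 0 (Nat.zero_le _))
  have h := isCornerInverse_compressSeq α hherm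
  obtain ⟨W, hW, hW0⟩ := h.exists_kernel_blockVec (S := pinv (s 0))
    (by rw [compressSeq_zero (hherm 0 (Nat.zero_le _))])
    (by rw [hcomm, hMP.mul_mul_right])
    (fun j hj => hs.mul_proj (by omega)) hV hker
  rw [blockHankel_shiftSeq_shortNegRecip α hherm le_rfl, blockMat_mul_blockVec,
    blockVec_eq_zero_iff] at hW0
  -- The congruent matrix is block diagonal, so dropping block `0` of `W` leaves a kernel column for
  -- its lower block.
  refine (schurL_eq_zero_iff ?_).mpr ⟨fun j => W (j + 1), hW, ?_⟩
  · exact posSemidef_blockHankel_mono (by omega) (hs.shortNegRecip.2 (by omega))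
  · rw [blockHankel_eq_blockMat, blockMat_mul_blockVec, blockVec_eq_zero_iff]
    intro i hi
    have := hW0 (i + 1) (by omega)
    rw [Finset.sum_range_succ'] at this
    simpa using this

theorem KCDFin.shortNegRecip (hs : KCDFin α (m + 1) s) :
    KCDFin α m (shortNegRecip (α : ℂ) s) := by
  have ht := hs.1.shortNegRecip
  refine ⟨ht, fun hm => ⟨ht.1, ?_⟩, fun hm => ?_⟩
  · obtain ⟨n, rfl⟩ := hm.two_dvd
    have h := (hs.2.2 (by simp)).2
    rw [show (2 * n + 1) / 2 = n by omega] at h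
    rw [show 2 * n / 2 = n by omega]
    exact schurL_shortNegRecip_eq_zero hs.1 h
  · obtain ⟨n, rfl⟩ := hm
    have h := (hs.2.1 (by simp [parity_simps])).2
    have ht2 := ht.2 (by omega)
    rw [show (2 * n + 1 + 1) / 2 = n + 1 by omega] at h
    rw [show (2 * n + 1 - 1) / 2 = n by omega] at ht2
    rw [show (2 * n + 1) / 2 = n by omega]
    exact ⟨ht2, schurL_shiftSeq_shortNegRecip_eq_zero hs.1 h⟩

theorem recipSeq_eq_zero {u : ℕ → Matrix (Fin q) (Fin q) ℂ} (hu : u 0 = 0) (j : ℕ) :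
    recipSeq u j = 0 := by
  cases j <;> simp [recipSeq, hu, pinv_zero]

/-- The case `m = 0`, where the index cannot drop: `L_0 = s_0 = 0` forces the whole reciprocal
sequence, hence `t`, to vanish. -/
theorem KCDFin.shortNegRecip_zero (hs : KCDFin α 0 s) :
    KCDFin α 0 (StieltjesSeq.shortNegRecip (α : ℂ) s) := by
  have h0 : s 0 = 0 := (hs.2.1 (by simp)).2
  have ht : StieltjesSeq.shortNegRecip (α : ℂ) s = fun _ => 0 := by
    funext j
    rw [StieltjesSeq.shortNegRecip, recipSeq_eq_zero (by exact h0), neg_zero]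
  have hH : (blockHankel (fun _ => (0 : Matrix (Fin q) (Fin q) ℂ)) 0).PosSemidef :=
    Matrix.PosSemidef.zero
  rw [ht]
  exact ⟨⟨hH, by simp⟩, fun _ => ⟨hH, rfl⟩, by simp⟩

theorem KCDFin.shortNegRecip_pred (hs : KCDFin α m s) :
    KCDFin α (m - 1) (StieltjesSeq.shortNegRecip (α : ℂ) s) := by
  cases m with
  | zero => exact hs.shortNegRecip_zero
  | succ m => exact hs.shortNegRecip

end StieltjesSeq
end

open StieltjesSeq in
theorem propositionP1542 (q : ℕ) (hq : 1 ≤ q) (α : ℝ) (κ : ℕ∞) (hκ : 1 ≤ κ)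
    (s : ℕ → Matrix (Fin q) (Fin q) ℂ) :
    (KGe α κ s → KGe α (κ - 1) (shortNegRecip (α : ℂ) s)) ∧
    (KGeExt α κ s → KGeExt α (κ - 1) (shortNegRecip (α : ℂ) s)) ∧
    (KGt α κ s → KGt α (κ - 1) (shortNegRecip (α : ℂ) s)) ∧
    (∀ m : ℕ, (m : ℕ∞) ≤ κ → KCDAt α m κ s →
      KCDAt α (max 0 (m - 1)) (κ - 1) (shortNegRecip (α : ℂ) s)) ∧
    (KCD α κ s → KCD α (κ - 1) (shortNegRecip (α : ℂ) s)) := by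
  have hge : KGe α κ s → KGe α (κ - 1) (shortNegRecip (α : ℂ) s) := by
    induction κ using ENat.recTopCoe with
    | top => exact fun h m => KGeFin.shortNegRecip (h (m + 1))
    | coe k =>
      obtain ⟨m, rfl⟩ : ∃ m, k = m + 1 := Nat.exists_eq_add_of_le' (by exact_mod_cast hκ)
      exact KGeFin.shortNegRecip
  refine ⟨hge, ?_, ?_, fun m _ h => ?_, ?_⟩
  · induction κ using ENat.recTopCoe with
    | top => exact hge
    | coe k =>
      obtain ⟨m, rfl⟩ : ∃ m, k = m + 1 := Nat.exists_eq_add_of_le' (by exact_mod_cast hκ)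
      rintro ⟨A, hA⟩
      change ∃ B, KGeFin α (m + 1) (Function.update (shortNegRecip (α : ℂ) s) (m + 1) B)
      -- The extending matrix is the last term of the transform of the extended sequence; the
      -- earlier terms do not depend on the extension.
      refine ⟨shortNegRecip (α : ℂ) (Function.update s (m + 1 + 1) A) (m + 1),
        (KGeFin.shortNegRecip hA).congr fun j hj => ?_⟩
      rcases eq_or_ne j (m + 1) with rfl | hne
      · rw [Function.update_self]
      · rw [Function.update_of_ne hne]
        refine shortNegRecip_congr (m := m) _ (fun i hi => ?_) (by omega)
        rw [Function.update_of_ne (by omega)]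
  · induction κ using ENat.recTopCoe with
    | top => exact fun h m => KGtFin.shortNegRecip (h (m + 1))
    | coe k =>
      obtain ⟨m, rfl⟩ : ∃ m, k = m + 1 := Nat.exists_eq_add_of_le' (by exact_mod_cast hκ)
      exact KGtFin.shortNegRecip
  · rw [Nat.zero_max]
    exact ⟨hge h.1, h.2.shortNegRecip_pred⟩
  · induction κ using ENat.recTopCoe with
    | top => exact fun ⟨h, m, hm⟩ => ⟨hge h, m - 1, hm.shortNegRecip_pred⟩
    | coe k => exact fun h => h.shortNegRecip_pred
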